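/- Consider instances with three agents and a finite set $M$ of $m\ge 2$ indivisible items. Agent $i$ has an additive valuation with item values $v_i(g)\ge 0$; every item is valued positively by at least one agent, and all agents have the same total value for all items, $v_1(M)=v_2(M)=v_3(M)$. The valuations are ternary: there are $a>b>0$ with $v_i(g)\in\{a,b,0\}$ for all $i,g$. An allocation is a triple $A=(A_1,A_2,A_3)$ of pairwise disjoint subsets of $M$, with social welfare $\mathrm{SW}(A)=\sum_i v_i(A_i)$; it is EF1 if for all agents $i\ne j$ with $A_j\neq\varnothing$ there is $g\in A_j$ with $v_i(A_i)\ge v_i(A_j\setminus\{g\})$. The price of EF1 is the supremum, over all such instances, of the maximum of $\mathrm{SW}$ over all allocations divided by the maximum of $\mathrm{SW}$ over all EF1 allocations. The algorithm Repeated-Max-Matching (RMM) starts with empty bundles. As long as items remain, it takes a non-wasteful maximum-weight matching $\mu$ in the bipartite graph between the agents and the remaining items, in which $i$ and $g$ are joined, with weight $v_i(g)$, iff $v_i(g)>0$; it adds $\mu_i$ to $A_i$ for each matched agent $i$ and removes the matched items. Here a maximum-weight matching $\mu$ is non-wasteful if there are no agent $i$ matched to an item $g$ and no unmatched remaining item $q$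 with $v_i(q)=v_i(g)$ and $\max_{j\ne i}v_j(q)<\max_{j\neq i}v_j(g)$. Theorem. On every such instance, whichever non-wasteful maximum-weight matchings are chosen, RMM terminates (a choice being available in every round), and its output $A$ is an EF1 allocation with $\mathrm{SW}(A)>0$ and $$\frac{\max_{B}\mathrm{SW}(B)}{\mathrm{SW}(A)}\le \frac{24}{19}\approx 1.26,$$ where $B$ ranges over all allocations. Consequently, the price of EF1 for three agents with additive ternary valuations lies in $[6/5,\,24/19]$. -/

import Mathlib

/-- An instance of the allocation problem with `n` agents: `m ≥ 2` indivisible items and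
nonnegative values `v i g`, such that every item is valued positively by some agent and all
agents have the same total value for all the items. -/
structure Instance (n : ℕ) where
  m : ℕ
  two_le_m : 2 ≤ m
  v : Fin n → Fin m → ℝ
  v_nonneg : ∀ i g, 0 ≤ v i g
  v_pos : ∀ g, ∃ i, 0 < v i g
  normalized : ∀ i j, ∑ g, v i g = ∑ g, v j g

namespace Instance

variable {n : ℕ} (I : Instance n)

/-- The values are ternary: there are `a > b > 0` such that every value is `a`, `b` or `0`. -/
def IsTernary : Prop :=
  ∃ a b : ℝ, 0 < b ∧ b < a ∧ ∀ i g, I.v i g = a ∨ I.v i g = b ∨ I.v i g = 0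

/-- The additive value of agent `i` for a set of items. -/
def value (i : Fin n) (S : Finset (Fin I.m)) : ℝ := ∑ g ∈ S, I.v i g

/-- A family of bundles, one for each agent. -/
abbrev Bundles : Type := Fin n → Finset (Fin I.m)

/-- An allocation is a family of pairwise disjoint bundles. -/
def IsAllocation (A : I.Bundles) : Prop := ∀ i j, i ≠ j → Disjoint (A i) (A j)

/-- Envy-freeness up to one item. -/
def IsEF1 (A : I.Bundles) : Prop :=
  ∀ i j, i ≠ j → (A j).Nonempty → ∃ g ∈ A j, I.value i ((A j).erase g) ≤ I.value i (A i)

/-- The social welfare. -/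
def welfare (A : I.Bundles) : ℝ := ∑ i, I.value i (A i)

/-- The maximum social welfare of an allocation (a maximum over a finite nonempty set). -/
noncomputable def maxWelfare : ℝ := sSup (I.welfare '' {A | I.IsAllocation A})

/-- The maximum social welfare of an EF1 allocation (a maximum over a finite set, which is
nonempty since it contains the family of empty bundles). -/
noncomputable def maxWelfareEF1 : ℝ :=
  sSup (I.welfare '' {A | I.IsAllocation A ∧ I.IsEF1 A})

/-- `μ` is a matching between the agents and the items of `R` in the bipartite graph that has an
edge between agent `i` and item `g` iff `v i g > 0`; `μ i = none` means that `i` is unmatched.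
An agent without an edge is necessarily unmatched, so there is no need to delete her. -/
def IsMatching (R : Finset (Fin I.m)) (μ : Fin n → Option (Fin I.m)) : Prop :=
  (∀ i g, μ i = some g → g ∈ R ∧ 0 < I.v i g) ∧
  ∀ i j g, μ i = some g → μ j = some g → i = j

/-- The weight of a matching: an edge between `i` and `g` has weight `v i g`. -/
def weight (μ : Fin n → Option (Fin I.m)) : ℝ := ∑ i, (μ i).elim 0 (I.v i)

/-- A matching of maximum weight. -/
def IsMaxMatching (R : Finset (Fin I.m)) (μ : Fin n → Option (Fin I.m)) : Prop :=
  I.IsMatching R μ ∧ ∀ μ', I.IsMatching R μ' → I.weight μ' ≤ I.weight μ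

/-- The maximum value that the agents other than `i` have for the item `g`. -/
noncomputable def othersMax (i : Fin n) (g : Fin I.m) : ℝ := ⨆ j : {j : Fin n // j ≠ i}, I.v j g

/-- A non-wasteful maximum-weight matching: no agent could replace her item by an unmatched item
of `R` that she values the same and for which the maximum value of the other agents is smaller. -/
def IsNonWasteful (R : Finset (Fin I.m)) (μ : Fin n → Option (Fin I.m)) : Prop :=
  I.IsMaxMatching R μ ∧
  ∀ i g q, μ i = some g → q ∈ R → (∀ j, μ j ≠ some q) → I.v i q = I.v i g →
    I.othersMax i g ≤ I.othersMax i q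

/-- A state of Repeated-Max-Matching: the remaining items and the current bundles. -/
structure RMMState where
  remaining : Finset (Fin I.m)
  bundle : I.Bundles

/-- The initial state. -/
def rmmInit : I.RMMState := ⟨Finset.univ, fun _ => ∅⟩

/-- One round of Repeated-Max-Matching. While items remain, any non-wasteful maximum-weight
matching is chosen, every matched agent gets her item, and the matched items are removed. -/
def RMMStep (s s' : I.RMMState) : Prop :=
  s.remaining.Nonempty ∧ ∃ μ, I.IsNonWasteful s.remaining μ ∧
    s'.remaining = s.remaining.filter (fun g => ∀ i, μ i ≠ some g) ∧
    ∀ i, s'.bundle i = s.bundle i ∪ (μ i).toFinset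

/-- The states that some run of Repeated-Max-Matching reaches. -/
def RMMReachable (s : I.RMMState) : Prop := Relation.ReflTransGen I.RMMStep I.rmmInit s

/-- `A` is the output of some run of Repeated-Max-Matching. -/
def RMMOutput (A : I.Bundles) : Prop :=
  ∃ s, I.RMMReachable s ∧ s.remaining = ∅ ∧ s.bundle = A

end Instance

/-- The price of EF1 for `n` agents with additive ternary valuations, as an extended real. -/
noncomputable def ternaryPriceEF1 (n : ℕ) : EReal :=
  ⨆ (I : Instance n) (_ : I.IsTernary), ((I.maxWelfare / I.maxWelfareEF1 : ℝ) : EReal)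

/-! No allocation has welfare above the sum over the items of their top values. A run attains the
top value of an item except in a loss, where an agent receives at value `b` an item that another
agent values at `a`. So the bound follows from `24 Σ w - 19 Σ M ≥ 0`, summed over rounds and agents.

Single rounds can violate this inequality, so normalization has to help: differences of total values
of two agents vanish, and multiples `p` and `q` of them can be added for free. The terms are then
regrouped by round (`score`), and `p`, `q` are chosen according to `a / b` so that every round is
nonnegative (`total_nonneg_of_score`).

Three properties of the matchings control the rounds. An agent never values a later item above her
own earlier one (`dom`). Exchanging items within a round gains nothing (`swap`, `rotate`). Finally,
an agent would have replaced her item by an equally good one that is less valuable to the others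
(`nonWasteful`). The first two make losses acyclic, so the agents can be ordered with losses
pointing forward only (`exists_ordered`). The third bounds what the others think of the target's
items before a pure loss (`PureLoss.before`) and what a losing agent can still value afterwards
(`Loss.after`). The remaining cases depend on which pure losses occur and when the last ones occur.

EF1 needs only `dom`, by shifting rounds by one. The lower bound `6/5` comes from `splitInstance`.
-/

/-- The values in a run of repeated matchings with values in `{a, b, 0}`: `w t i j` is the value of
agent `i` for the item that agent `j` receives in round `t` (zero if there is none), and `M t j` is
the maximum value of an agent for that item. -/
structure RoundProfile (a b : ℝ) (T : ℕ) where
  w : ℕ → Fin 3 → Fin 3 → ℝ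
  M : ℕ → Fin 3 → ℝ
  b_pos : 0 < b
  b_lt : b < a
  ternary : ∀ t i j, w t i j = a ∨ w t i j = b ∨ w t i j = 0
  le_M : ∀ t i j, w t i j ≤ M t j
  M_eq : ∀ t j, ∃ i, M t j = w t i j
  M_eq_zero : ∀ t j, w t j j = 0 → M t j = 0
  swap : ∀ t i j, i ≠ j → w t j i + w t i j ≤ w t i i + w t j j
  rotate : ∀ t i j k, i ≠ j → i ≠ k → j ≠ k →
    w t j i + w t k j + w t i k ≤ w t i i + w t j j + w t k k
  dom : ∀ s t i j, s < t → w t i j ≤ w s i i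
  nonWasteful : ∀ s t i j c, s < t → 0 < w s i i → w t i j = w s i i →
    (∀ l, l ≠ i → w t l j ≤ c) → ∀ l, l ≠ i → w s l i ≤ c
  zero_of_le : ∀ t i j, T ≤ t → w t i j = 0
  normalized : ∀ i j, ∑ t ∈ Finset.range T, ∑ x, w t i x = ∑ t ∈ Finset.range T, ∑ x, w t j x

/-! ### Losses, their timing and their acyclicity -/

namespace RoundProfile

theorem sum_distinct {i j k : Fin 3} (hij : i ≠ j) (hik : i ≠ k) (hjk : j ≠ k) (f : Fin 3 → ℝ) :
    ∑ x, f x = f i + f j + f k := by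
  have : (Finset.univ : Finset (Fin 3)) = {i, j, k} := by
    revert i j k; decide
  rw [this, Finset.sum_insert (by simp [hij, hik]), Finset.sum_insert (by simp [hjk]),
    Finset.sum_singleton]
  ring

theorem eq_of_distinct {i j k : Fin 3} (hij : i ≠ j) (hik : i ≠ k) (hjk : j ≠ k) (l : Fin 3) :
    l = i ∨ l = j ∨ l = k := by
  revert i j k l; decide

variable {a b : ℝ} {T : ℕ} (P : RoundProfile a b T)

/-- In round `t`, agent `i` receives at value `b` an item that agent `j` values `a`. -/
def Loss (t : ℕ) (i j : Fin 3) : Prop := P.w t i i = b ∧ P.w t j i = a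

/-- A loss of `i` on `j` where nobody but `j` has value `a` for the item. -/
def PureLoss (t : ℕ) (i j : Fin 3) : Prop := P.Loss t i j ∧ ∀ l, l ≠ j → P.w t l i ≤ b

theorem w_nonneg (t : ℕ) (i j : Fin 3) : 0 ≤ P.w t i j := by
  have := P.b_pos; have := P.b_lt
  rcases P.ternary t i j with h | h | h <;> rw [h] <;> linarith

theorem w_le (t : ℕ) (i j : Fin 3) : P.w t i j ≤ a := by
  have := P.b_pos; have := P.b_lt
  rcases P.ternary t i j with h | h | h <;> rw [h] <;> linarith

theorem eq_a_of_lt {t : ℕ} {i j : Fin 3} (h : b < P.w t i j) : P.w t i j = a := by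
  have := P.b_pos
  rcases P.ternary t i j with h' | h' | h'
  · exact h'
  · linarith
  · linarith

theorem eq_zero_of_lt {t : ℕ} {i j : Fin 3} (h : P.w t i j < b) : P.w t i j = 0 := by
  have := P.b_lt
  rcases P.ternary t i j with h' | h' | h'
  · linarith
  · linarith
  · exact h'

variable {P}

theorem Loss.ne {t : ℕ} {i j : Fin 3} (h : P.Loss t i j) : i ≠ j := by
  rintro rfl
  have := P.b_lt
  have := h.1.symm.trans h.2
  linarith

theorem Loss.lt {t : ℕ} {i j : Fin 3} (h : P.Loss t i j) : t < T := by
  by_contra hT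
  have := P.zero_of_le t i i (not_lt.mp hT)
  have := P.b_pos
  linarith [h.1]

theorem Loss.M_eq {t : ℕ} {i j : Fin 3} (h : P.Loss t i j) : P.M t i = a := by
  obtain ⟨l, hl⟩ := P.M_eq t i
  exact le_antisymm (hl ▸ P.w_le t l i) (h.2.symm.trans_le (P.le_M t j i))

/-- The agent on whom an item is lost has received value `a` in all earlier rounds. -/
theorem Loss.target_before {s t : ℕ} {i j : Fin 3} (h : P.Loss t i j) (hst : s < t) :
    P.w s j j = a :=
  le_antisymm (P.w_le s j j) (h.2.symm.trans_le (P.dom s t j i hst))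

/-- Before being a target, `j` receives value `a` in every round, whereas in a round of her own loss
she receives only `b`. -/
theorem Loss.le_of_loss {s t : ℕ} {i j k : Fin 3} (h : P.Loss t i j) (h' : P.Loss s j k) :
    t ≤ s := by
  by_contra hst
  have h1 := h.target_before (not_le.mp hst)
  have := P.b_lt
  linarith [h'.1]

/-- Exchanging the two items must not gain. The second alternative, where the target too gets only
`b`, is the exceptional case that needs separate estimates below (the hypotheses `hweird`). -/
theorem Loss.swap_cases {t : ℕ} {i j : Fin 3} (h : P.Loss t i j) :
    (P.w t j j = a ∧ P.w t i j ≤ b) ∨ (a ≤ 2 * b ∧ P.w t j j = b ∧ P.w t i j = 0) := by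
  have hs := P.swap t i j h.ne
  have h0 := P.w_nonneg t i j
  have := P.b_lt
  rw [h.1, h.2] at hs
  rcases P.ternary t j j with hj | hj | hj
  · left; exact ⟨hj, by linarith⟩
  · right; exact ⟨by linarith, hj, P.eq_zero_of_lt (by linarith)⟩
  · linarith

/-- Before a pure loss on `k`, agent `k` receives value `a` from items that the others value at
most `b`. -/
theorem PureLoss.before {s t : ℕ} {i k : Fin 3} (h : P.PureLoss t i k) (hst : s < t) :
    P.w s k k = a ∧ ∀ l, l ≠ k → P.w s l k ≤ b := by
  have h1 := h.1.target_before hst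
  have := P.b_pos.trans P.b_lt
  -- The item lost in round `t` was still available in round `s`, and `k` values it as much as the
  -- item she took.
  exact ⟨h1, P.nonWasteful s t k i b hst (by linarith) (by rw [h1, h.1.2]) h.2⟩

/-- After a loss of `i`, the items with a positive value for `i` have value `b` for `i` and value
`a` for somebody. -/
theorem Loss.after {s t : ℕ} {i j : Fin 3} (h : P.Loss s i j) (hst : s < t) (x : Fin 3) :
    P.w t i x = 0 ∨ P.w t i x = b ∧ P.M t x = a := by
  have hd := P.dom s t i x hst
  have hb := P.b_pos
  have hab := P.b_lt
  rw [h.1] at hd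
  rcases P.ternary t i x with hw | hw | hw
  · linarith
  · right
    -- If nobody valued this item at `a`, then `i` would have had to prefer it in round `s` to the
    -- lost item, which `j` values at `a`.
    refine ⟨hw, ?_⟩
    obtain ⟨l, hl⟩ := P.M_eq t x
    by_contra hM
    have hle : ∀ l, l ≠ i → P.w t l x ≤ b := by
      intro l _
      by_contra hlt
      apply hM
      exact le_antisymm (hl ▸ P.w_le ..)
        ((P.eq_a_of_lt (not_le.mp hlt)).symm.trans_le (P.le_M t l x))
    have := P.nonWasteful s t i x b hst (by rw [h.1]; exact hb) (by rw [hw, h.1]) hle j h.ne.symm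
    linarith [h.2]
  · left; exact hw

theorem Loss.after_le {s t : ℕ} {i j : Fin 3} (h : P.Loss s i j) (hst : s < t) (x : Fin 3) :
    P.w t i x ≤ b := by
  have := P.b_pos
  rcases h.after hst x with h | h
  · linarith
  · exact h.1.le

variable (P)

theorem M_eq_or_loss (t : ℕ) (j : Fin 3) : P.M t j = P.w t j j ∨ ∃ i, P.Loss t j i := by
  obtain ⟨i, hi⟩ := P.M_eq t j
  have hb := P.b_pos
  have hab := P.b_lt
  rcases P.ternary t j j with h | h | h
  · left
    exact le_antisymm (by rw [hi, h]; exact P.w_le ..) (P.le_M t j j)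
  · rcases P.ternary t i j with h' | h' | h'
    · exact .inr ⟨i, h, h'⟩
    · left; rw [hi, h, h']
    · have := P.le_M t j j
      rw [hi, h, h'] at this
      linarith
  · left; rw [h, P.M_eq_zero t j h]

theorem not_loss_symm {s t : ℕ} {i j : Fin 3} (h : P.Loss s i j) (h' : P.Loss t j i) : False := by
  obtain rfl := le_antisymm (h.le_of_loss h') (h'.le_of_loss h)
  have := P.swap s i j h.ne
  rw [h.1, h.2, h'.1, h'.2] at this
  linarith [P.b_lt]

/-- By `Loss.le_of_loss` the losses of a cycle all fall in one round, and there rotating the items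
would increase the weight. -/
theorem not_loss_cycle {r s t : ℕ} {i j k : Fin 3} (h₁ : P.Loss r i j) (h₂ : P.Loss s j k)
    (h₃ : P.Loss t k i) : False := by
  have h12 := h₁.le_of_loss h₂
  have h23 := h₂.le_of_loss h₃
  have h31 := h₃.le_of_loss h₁
  obtain rfl : r = s := by omega
  obtain rfl : r = t := by omega
  have := P.rotate r i j k h₁.ne h₃.ne.symm h₂.ne
  rw [h₁.1, h₁.2, h₂.1, h₂.2, h₃.1, h₃.2] at this
  linarith [P.b_lt]

/-- The agents are `i`, `j`, `k`, and losses are only on later agents in this order. -/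
structure Ordered (i j k : Fin 3) : Prop where
  ij : i ≠ j
  ik : i ≠ k
  jk : j ≠ k
  not_ji : ∀ t, ¬ P.Loss t j i
  not_ki : ∀ t, ¬ P.Loss t k i
  not_kj : ∀ t, ¬ P.Loss t k j

/-- If every agent had a loss, following three losses from agent `0` would close a cycle of length
two or three. Hence some agent never loses and can be put last; the other two cannot lose on each
other. -/
theorem exists_ordered : ∃ i j k : Fin 3, P.Ordered i j k := by
  obtain ⟨k, hk⟩ : ∃ k, ∀ t l, ¬ P.Loss t k l := by
    by_contra! h
    obtain ⟨r, j, hj⟩ := h 0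
    obtain ⟨s, k, hk⟩ := h j
    obtain ⟨t, l, hl⟩ := h k
    have hk0 : (0 : Fin 3) ≠ k := by
      rintro rfl
      exact P.not_loss_symm hj hk
    rcases eq_of_distinct hj.ne hk0 hk.ne l with rfl | rfl | rfl
    · exact P.not_loss_cycle hj hk hl
    · exact P.not_loss_symm hk hl
    · exact hl.ne rfl
  obtain ⟨i, j, hij, hik, hjk⟩ :=
    (by decide : ∀ k : Fin 3, ∃ i j : Fin 3, i ≠ j ∧ i ≠ k ∧ j ≠ k) k
  by_cases h : ∀ t, ¬ P.Loss t j i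
  · exact ⟨i, j, k, hij, hik, hjk, h, fun t => hk t i, fun t => hk t j⟩
  · push Not at h
    obtain ⟨s, hs⟩ := h
    exact ⟨j, i, k, hij.symm, hjk, hik, fun t ht => P.not_loss_symm hs ht, fun t => hk t j,
      fun t => hk t i⟩

/-- The contribution of the item of agent `x` in round `t`: the target `24 w - 19 M` plus multiples
of differences that add up to zero because the valuations are normalized. -/
def score (p q : ℝ) (i j k : Fin 3) (t : ℕ) (x : Fin 3) : ℝ :=
  24 * P.w t x x - 19 * P.M t x + p * (P.w t j x - P.w t i x) + q * (P.w t k x - P.w t i x)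

/-- Summed over all rounds, the terms with `p` and `q` cancel by normalization. -/
theorem total_nonneg_of_score {p q : ℝ} {i j k : Fin 3} (hij : i ≠ j) (hik : i ≠ k) (hjk : j ≠ k)
    (h : ∀ t, 0 ≤ P.score p q i j k t i + P.score p q i j k t j + P.score p q i j k t k) :
    0 ≤ ∑ t ∈ Finset.range T, ∑ x, (24 * P.w t x x - 19 * P.M t x) := by
  have h1 : 0 ≤ ∑ t ∈ Finset.range T, ∑ x, P.score p q i j k t x :=
    Finset.sum_nonneg fun t _ => by rw [sum_distinct hij hik hjk]; exact h t
  have h2 : ∑ t ∈ Finset.range T, ∑ x, P.score p q i j k t x =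
      ∑ t ∈ Finset.range T, ∑ x, (24 * P.w t x x - 19 * P.M t x) +
      p * (∑ t ∈ Finset.range T, ∑ x, P.w t j x - ∑ t ∈ Finset.range T, ∑ x, P.w t i x) +
      q * (∑ t ∈ Finset.range T, ∑ x, P.w t k x - ∑ t ∈ Finset.range T, ∑ x, P.w t i x) := by
    simp only [← Finset.sum_sub_distrib, Finset.mul_sum, ← Finset.sum_add_distrib, score]
  rw [h2, P.normalized j i, P.normalized k i] at h1
  simpa using h1

end RoundProfile

/-! ### Round estimates when `i` has no pure loss on `j` -/

namespace RoundProfile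

variable {a b : ℝ} {T : ℕ} {P : RoundProfile a b T} {i j k : Fin 3}

namespace Ordered

theorem M_last (o : P.Ordered i j k) (t : ℕ) : P.M t k = P.w t k k := by
  rcases P.M_eq_or_loss t k with h | ⟨l, hl⟩
  · exact h
  · rcases eq_of_distinct o.ij o.ik o.jk l with rfl | rfl | rfl
    · exact (o.not_ki t hl).elim
    · exact (o.not_kj t hl).elim
    · exact (hl.ne rfl).elim

theorem pureLoss_middle (o : P.Ordered i j k) {t : ℕ} {l : Fin 3} (h : P.Loss t j l) :
    P.PureLoss t j k := by
  obtain rfl : l = k := by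
    rcases eq_of_distinct o.ij o.ik o.jk l with rfl | rfl | rfl
    · exact (o.not_ji t h).elim
    · exact (h.ne rfl).elim
    · rfl
  refine ⟨h, fun x hx => ?_⟩
  rcases eq_of_distinct o.ij o.ik o.jk x with rfl | rfl | rfl
  · by_contra hlt
    exact o.not_ji t ⟨h.1, P.eq_a_of_lt (not_le.mp hlt)⟩
  · exact h.1.le
  · exact (hx rfl).elim

theorem middle_cases (o : P.Ordered i j k) (t : ℕ) :
    P.M t j = P.w t j j ∨ P.PureLoss t j k := by
  rcases P.M_eq_or_loss t j with h | ⟨l, hl⟩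
  · exact .inl h
  · exact .inr (o.pureLoss_middle hl)

theorem first_loss_cases (o : P.Ordered i j k) {t : ℕ} {l : Fin 3} (h : P.Loss t i l) :
    P.PureLoss t i j ∨ P.Loss t i k := by
  by_cases hk : P.Loss t i k
  · exact .inr hk
  left
  obtain rfl : l = j := by
    rcases eq_of_distinct o.ij o.ik o.jk l with rfl | rfl | rfl
    · exact (h.ne rfl).elim
    · rfl
    · exact (hk h).elim
  refine ⟨h, fun x hx => ?_⟩
  rcases eq_of_distinct o.ij o.ik o.jk x with rfl | rfl | rfl
  · exact h.1.le
  · exact (hx rfl).elim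
  · by_contra hlt
    exact hk ⟨h.1, P.eq_a_of_lt (not_le.mp hlt)⟩

theorem first_cases (o : P.Ordered i j k) (t : ℕ) :
    P.M t i = P.w t i i ∨ P.PureLoss t i j ∨ P.Loss t i k := by
  rcases P.M_eq_or_loss t i with h | ⟨l, hl⟩
  · exact .inl h
  · exact .inr (o.first_loss_cases hl)

end Ordered

/-- If `i` has lost an item earlier and does not lose one now, she gets nothing. -/
theorem Loss.own_eq_zero {s t : ℕ} {l : Fin 3} (h : P.Loss s i l) (hst : s < t)
    (hM : P.M t i = P.w t i i) : P.w t i i = 0 ∧ P.M t i = 0 := by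
  have hab := P.b_lt
  rcases h.after hst i with h0 | ⟨h0, h1⟩
  · exact ⟨h0, hM.trans h0⟩
  · linarith

/-- If no item is lost by `i` on `j` alone, it suffices to compare the values of `k` with those of
`i`, with a weight `l` that depends on `a / b`. -/
theorem Ordered.total_nonneg_of_no_pureLoss (o : P.Ordered i j k) {l : ℝ} (h5 : 5 ≤ l)
    (hnn : 0 ≤ (15 - l) * a - l * b)
    (hll : 0 ≤ (48 - 3 * l) * b + (3 * l - 33) * a) (hpost : l * b ≤ 5 * a)
    (hweird : a ≤ 2 * b → 0 ≤ (53 - l) * b + (2 * l - 38) * a ∧ 0 ≤ 29 * b + (l - 19) * a)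
    (hlossy : ∃ t x, P.Loss t i x) (hij : ∀ t, ¬ P.PureLoss t i j)
    {Tp : ℕ} {m : Fin 3} (hm : P.PureLoss Tp m k) (hlast : ∀ t x, P.PureLoss t x k → t ≤ Tp) :
    0 ≤ ∑ t ∈ Finset.range T, ∑ x, (24 * P.w t x x - 19 * P.M t x) := by
  have hb := P.b_pos
  have hab := P.b_lt
  have hi_loss : ∀ t x, P.Loss t i x → P.Loss t i k := fun t x h =>
    (o.first_loss_cases h).resolve_left (hij t)
  have hi_cases : ∀ t, P.M t i = P.w t i i ∨ P.Loss t i k := fun t =>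
    (o.first_cases t).imp_right fun h => h.resolve_left (hij t)
  have hm_cases : m = i ∨ m = j := by
    rcases eq_of_distinct o.ij o.ik o.jk m with h | h | h
    · exact .inl h
    · exact .inr h
    · exact (hm.1.ne h).elim
  -- agent `i` has lost an item by round `Tp`
  obtain ⟨s, hsTp, hs⟩ : ∃ s, s ≤ Tp ∧ P.Loss s i k := by
    rcases hm_cases with rfl | rfl
    · exact ⟨Tp, le_rfl, hm.1⟩
    · obtain ⟨s, x, hs⟩ := hlossy
      have hs := hi_loss s x hs
      refine ⟨s, ?_, hs⟩
      -- After round `Tp`, where `j` gets only `b`, nothing is worth `a` to `j`. A later loss of `i`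
      -- on `k` would thus be pure, against the choice of `Tp`.
      by_contra hlt
      refine hlt (hlast s i ⟨hs, fun y hy => ?_⟩)
      rcases eq_of_distinct o.ij o.ik o.jk y with rfl | rfl | rfl
      · exact hs.1.le
      · exact (P.dom Tp s _ _ (not_le.mp hlt)).trans hm.1.1.le
      · exact (hy rfl).elim
  -- lower bounds for the contributions of the items of `i` and `j`
  have score_i : ∀ t, P.M t i = P.w t i i → (5 - l) * a ≤ P.score 0 l i j k t i := by
    intro t h
    have h1 := P.w_nonneg t k i
    have h2 := P.w_le t i i
    unfold score
    rw [h]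
    nlinarith
  have score_i' : ∀ t, P.Loss t i k →
      P.score 0 l i j k t i = (24 - l) * b + (l - 19) * a := by
    intro t h
    unfold score
    rw [h.M_eq, h.1, h.2]
    ring
  have score_j : ∀ t, P.M t j = P.w t j j → (5 - l) * a ≤ P.score 0 l i j k t j := by
    intro t h
    have h1 := P.w_nonneg t k j
    have h2 := P.w_le t j j
    have h3 := P.le_M t i j
    rw [h] at h3
    unfold score
    rw [h]
    nlinarith
  have score_j' : ∀ t, P.PureLoss t j k →
      (24 - l) * b + (l - 19) * a ≤ P.score 0 l i j k t j := by
    intro t h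
    have h1 := h.2 i o.ik
    unfold score
    rw [h.1.M_eq, h.1.1, h.1.2]
    nlinarith
  have score_k : ∀ t, P.score 0 l i j k t k = (5 + l) * P.w t k k - l * P.w t i k := by
    intro t
    unfold score
    rw [o.M_last t]
    ring
  -- rounds in which `k` receives an item of value `a` that `i` values at most `b`
  have main : ∀ t, P.w t k k = a → P.w t i k ≤ b →
      0 ≤ P.score 0 l i j k t i + P.score 0 l i j k t j + P.score 0 l i j k t k := by
    intro t hk hik
    have hk' : (5 + l) * a - l * b ≤ P.score 0 l i j k t k := by
      rw [score_k, hk]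
      nlinarith
    -- The extreme cases are `hnn` and `hll`; the bound for exactly one loss is the average of these
    -- two.
    rcases hi_cases t with h1 | h1 <;> rcases o.middle_cases t with h2 | h2
    · linarith [score_i t h1, score_j t h2]
    · linarith [score_i t h1, score_j' t h2]
    · linarith [score_i' t h1, score_j t h2]
    · linarith [score_i' t h1, score_j' t h2]
  refine P.total_nonneg_of_score (p := 0) (q := l) o.ij o.ik o.jk fun t => ?_
  -- Before `Tp`, the items of `k` pay for the round. After `Tp`, `j` loses nothing, and `i` values
  -- at most `b` whatever she still values.
  rcases lt_trichotomy t Tp with ht | rfl | ht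
  · obtain ⟨h1, h2⟩ := hm.before ht
    exact main t h1 (h2 i o.ik)
  · by_cases hl : P.Loss t i k
    · rcases hl.swap_cases with ⟨h1, h2⟩ | ⟨h0, h1, h2⟩
      · exact main t h1 h2
      · obtain ⟨hw1, hw2⟩ := hweird h0
        have hk' : P.score 0 l i j k t k = (5 + l) * b := by
          rw [score_k, h1, h2]
          ring
        rcases o.middle_cases t with h2 | h2
        · linarith [score_i' t hl, score_j t h2]
        · linarith [score_i' t hl, score_j' t h2]
    · obtain rfl : m = j := hm_cases.resolve_left fun h => hl (h ▸ hm.1)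
      have hst : s < t := lt_of_le_of_ne hsTp fun h => hl (h ▸ hs)
      rcases hm.1.swap_cases with ⟨h1, h2⟩ | ⟨h0, h1, h2⟩
      · exact main t h1 (hs.after_le hst k)
      · obtain ⟨hw1, hw2⟩ := hweird h0
        obtain ⟨h3, h4⟩ := hs.own_eq_zero hst ((hi_cases t).resolve_right hl)
        have h5 : P.w t i k = 0 := by
          rcases hs.after hst k with h | ⟨-, h⟩
          · exact h
          · linarith [o.M_last t]
        have hi0 : 0 ≤ P.score 0 l i m k t i := by
          have := P.w_nonneg t k i
          unfold score
          rw [h3, h4]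
          nlinarith
        have hk' : P.score 0 l i m k t k = (5 + l) * b := by
          rw [score_k, h1, h5]
          ring
        linarith [score_j' t hm]
  · have hst : s < t := hsTp.trans_lt ht
    have hMj : P.M t j = P.w t j j :=
      (o.middle_cases t).resolve_right fun h => absurd (hlast t j h) (not_le.mpr ht)
    have hj0 : 0 ≤ P.score 0 l i j k t j := by
      have h1 := P.w_nonneg t k j
      have h2 := P.w_nonneg t j j
      unfold score
      rw [hMj]
      rcases hs.after hst j with h | ⟨h, h'⟩
      · rw [h]; nlinarith
      · rw [h, ← hMj, h']; nlinarith
    rcases hi_cases t with h1 | h1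
    · obtain ⟨h3, h4⟩ := hs.own_eq_zero hst h1
      have hi0 : 0 ≤ P.score 0 l i j k t i := by
        have := P.w_nonneg t k i
        unfold score
        rw [h3, h4]
        nlinarith
      have hk0 : 0 ≤ P.score 0 l i j k t k := by
        have h2 := P.w_nonneg t k k
        rw [score_k]
        rcases hs.after hst k with h | ⟨h, h'⟩
        · rw [h]; nlinarith
        · rw [h, ← o.M_last t, h']; nlinarith
      linarith
    · rcases h1.swap_cases with ⟨h2, h3⟩ | ⟨h0, h2, h3⟩
      · have hk' : (5 + l) * a - l * b ≤ P.score 0 l i j k t k := by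
          rw [score_k, h2]
          nlinarith
        linarith [score_i' t h1]
      · obtain ⟨hw1, hw2⟩ := hweird h0
        have hk' : P.score 0 l i j k t k = (5 + l) * b := by
          rw [score_k, h2, h3]
          ring
        linarith [score_i' t h1]

end RoundProfile

/-! ### Shared losses, and pure losses on both later agents -/

namespace RoundProfile

variable {a b : ℝ} {T : ℕ} {P : RoundProfile a b T} {i j k : Fin 3}

/-- The case that all losses are of items that both `j` and `k` value `a`. -/
theorem Ordered.total_nonneg_of_shared (o : P.Ordered i j k) (hj : ∀ t x, ¬ P.Loss t j x)
    (hi : ∀ t x, P.Loss t i x → P.Loss t i j ∧ P.Loss t i k) :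
    0 ≤ ∑ t ∈ Finset.range T, ∑ x, (24 * P.w t x x - 19 * P.M t x) := by
  have hb := P.b_pos
  have hab := P.b_lt
  -- The weight `5 = 24 - 19` makes every term nonnegative if `i` loses nothing. If she does,
  -- `swap_cases` applies to both other agents.
  refine P.total_nonneg_of_score (p := 0) (q := 5) o.ij o.ik o.jk fun t => ?_
  have hMj : P.M t j = P.w t j j :=
    (o.middle_cases t).resolve_right fun h => hj t k h.1
  have hMk := o.M_last t
  have hij := P.le_M t i j
  have hik := P.le_M t i k
  have hki := P.w_nonneg t k i
  have hkj := P.w_nonneg t k j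
  have hkk := P.w_nonneg t k k
  rcases P.M_eq_or_loss t i with h | ⟨x, hx⟩
  · unfold score
    linarith
  · obtain ⟨h1, h2⟩ := hi t x hx
    have h3 := h1.M_eq
    have h4 := h2.1
    have h5 := h2.2
    unfold score
    rcases h1.swap_cases with ⟨u1, u2⟩ | ⟨u0, u1, u2⟩ <;>
      rcases h2.swap_cases with ⟨v1, v2⟩ | ⟨v0, v1, v2⟩ <;> linarith

/-- The case that `i` loses an item on `j` alone and that an item is lost on `k` alone not before
the last such loss. -/
theorem Ordered.total_nonneg_of_pureLoss (o : P.Ordered i j k) {p q : ℝ} (hp : 0 ≤ p)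
    (hpq : p ≤ q) (h5 : 5 ≤ p + q) (hpost : (p + q) * b ≤ (5 + p) * a)
    (hone : 0 ≤ (24 - 2 * (p + q)) * b + (2 * q - 14) * a)
    (htwo : 0 ≤ (48 + p - 3 * (p + q)) * b + (3 * q - 33) * a)
    (hpre : 0 ≤ 15 * a - 2 * (p + q) * b)
    (hpre' : 0 ≤ (24 - 3 * (p + q)) * b + (2 * p + q - 9) * a)
    (hweird : a ≤ 2 * b → 0 ≤ (29 - p) * b + (q - 19) * a ∧
      0 ≤ (53 - (p + q)) * b + (2 * q - 38) * a ∧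
      0 ≤ (29 + p - 2 * (p + q)) * b + (p + q - 14) * a ∧
      0 ≤ (48 + p - 2 * (p + q)) * b + (p + 2 * q - 33) * a)
    (hchain : 2 * a ≤ 3 * b → 0 ≤ 53 * b + (p + q - 38) * a)
    {s : ℕ} (hs : P.PureLoss s i j) (hlast : ∀ t, P.PureLoss t i j → t ≤ s)
    {Tp : ℕ} {m : Fin 3} (hm : P.PureLoss Tp m k) (hsTp : s ≤ Tp) :
    0 ≤ ∑ t ∈ Finset.range T, ∑ x, (24 * P.w t x x - 19 * P.M t x) := by
  have hb := P.b_pos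
  have hab := P.b_lt
  have hq : 0 ≤ q := hp.trans hpq
  have hpa : p * a ≤ q * a := by nlinarith
  have hpb : 0 ≤ p * b := by positivity
  -- lower bounds for the contributions of the items
  have lossIK : ∀ t, P.Loss t i k →
      (24 - (p + q)) * b + (q - 19) * a ≤ P.score p q i j k t i := by
    intro t h
    have := P.w_nonneg t j i
    unfold score
    rw [h.M_eq, h.1, h.2]
    nlinarith
  have lossIJ : ∀ t, P.Loss t i j →
      (24 - (p + q)) * b + (p - 19) * a ≤ P.score p q i j k t i := by
    intro t h
    have := P.w_nonneg t k i
    unfold score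
    rw [h.M_eq, h.1, h.2]
    nlinarith
  have lossJ : ∀ t, P.PureLoss t j k → P.score p q i j k t j =
      (24 + p) * b + (q - 19) * a - (p + q) * P.w t i j := by
    intro t h
    unfold score
    rw [h.1.M_eq, h.1.1, h.1.2]
    ring
  have keepJ : ∀ t, P.M t j = P.w t j j →
      (5 + p) * P.w t j j - (p + q) * P.w t i j ≤ P.score p q i j k t j := by
    intro t h
    have := P.w_nonneg t k j
    unfold score
    rw [h]
    nlinarith
  have keepK : ∀ t, (5 + q) * P.w t k k - (p + q) * P.w t i k ≤ P.score p q i j k t k := by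
    intro t
    have := P.w_nonneg t j k
    unfold score
    rw [o.M_last t]
    nlinarith
  have keepK' : ∀ t, P.w t k k = a → P.w t i k ≤ b →
      (5 + q) * a - (p + q) * b ≤ P.score p q i j k t k := by
    intro t h h'
    have := keepK t
    rw [h] at this
    nlinarith
  have keepJ' : ∀ t, P.w t j j = a → P.w t i j ≤ b →
      (5 + p) * a - (p + q) * b ≤ P.score p q i j k t j := by
    intro t h h'
    have hM : P.M t j = P.w t j j := by
      rcases o.middle_cases t with h1 | h1
      · exact h1
      · linarith [h1.1.1]
    have := keepJ t hM
    rw [h] at this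
    nlinarith
  refine P.total_nonneg_of_score (p := p) (q := q) o.ij o.ik o.jk fun t => ?_
  -- Before `s`, both `j` and `k` get value `a` from items that `i` values at most `b`. After `s`,
  -- losses of `i` are on `k`, and her positive values are `b` on items of top value `a`.
  rcases lt_trichotomy t s with ht | rfl | ht
  · obtain ⟨hj1, hj2⟩ := hs.before ht
    obtain ⟨hk1, hk2⟩ := hm.before (ht.trans_le hsTp)
    have h1 := keepJ' t hj1 (hj2 i o.ij)
    have h2 := keepK' t hk1 (hk2 i o.ik)
    rcases o.first_cases t with h | h | h
    · have h3 : (5 - (p + q)) * a ≤ P.score p q i j k t i := by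
        have := P.w_nonneg t j i
        have := P.w_nonneg t k i
        have := P.w_le t i i
        unfold score
        rw [h]
        nlinarith [mul_nonneg hp (P.w_nonneg t j i), mul_nonneg hq (P.w_nonneg t k i)]
      linarith
    · linarith [lossIJ t h.1]
    · linarith [lossIK t h]
  · have hi := lossIJ t hs.1
    rcases hs.1.swap_cases with ⟨h1, h2⟩ | ⟨h0, h1, h2⟩
    · have hlt : t < Tp := by
        refine lt_of_le_of_ne hsTp ?_
        rintro rfl
        rcases eq_of_distinct o.ij o.ik o.jk m with rfl | rfl | rfl
        · linarith [hs.2 k o.jk.symm, hm.1.2]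
        · linarith [hm.1.1]
        · exact hm.1.ne rfl
      obtain ⟨hk1, hk2⟩ := hm.before hlt
      linarith [keepJ' t h1 h2, keepK' t hk1 (hk2 i o.ik)]
    · obtain ⟨hw1, hw2, hw3, hw4⟩ := hweird h0
      rcases hsTp.lt_or_eq with hlt | rfl
      · obtain ⟨hk1, hk2⟩ := hm.before hlt
        have hk := keepK' t hk1 (hk2 i o.ik)
        rcases o.middle_cases t with h | h
        · have := keepJ t h
          rw [h1, h2] at this
          linarith
        · have := lossJ t h
          rw [h2] at this
          linarith
      · obtain rfl : m = j := by
          rcases eq_of_distinct o.ij o.ik o.jk m with rfl | rfl | rfl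
          · linarith [hs.2 k o.jk.symm, hm.1.2]
          · rfl
          · exact (hm.1.ne rfl).elim
        -- Here `i` loses on `j` and `j` on `k` in the same round. Passing the items along this
        -- chain must not gain, which forces `2 * a ≤ 3 * b` if `k` gets only `b`.
        have hr := P.rotate t i m k o.ij o.ik o.jk
        rw [hs.1.1, hs.1.2, hm.1.1, hm.1.2] at hr
        have h0' := P.w_nonneg t i k
        have hj := lossJ t hm
        rw [h2] at hj
        rcases hm.1.swap_cases with ⟨h3, h4⟩ | ⟨-, h3, h4⟩
        · have : P.w t i k ≤ b := by
            by_contra hlt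
            linarith [P.eq_a_of_lt (not_le.mp hlt)]
          linarith [keepK' t h3 this]
        · rw [h3] at hr
          have hc := hchain (by linarith)
          have h5 : P.w t i k = 0 := P.eq_zero_of_lt (by linarith)
          have := keepK t
          rw [h3, h5] at this
          linarith
  · have hw : ∀ x, P.w t i x ≤ b := hs.1.after_le ht
    have hj0 : P.M t j = P.w t j j → 0 ≤ P.score p q i j k t j := by
      intro h
      have h1 := keepJ t h
      have h2 := P.w_nonneg t j j
      rcases hs.1.after ht j with h3 | ⟨h3, h4⟩
      · rw [h3] at h1
        nlinarith
      · rw [h3, ← h, h4] at h1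
        linarith
    have hk0 : 0 ≤ P.score p q i j k t k := by
      have h1 := keepK t
      have h2 := P.w_nonneg t k k
      rcases hs.1.after ht k with h3 | ⟨h3, h4⟩
      · rw [h3] at h1
        nlinarith
      · rw [h3, ← o.M_last t, h4] at h1
        linarith
    have hkloss : ∀ x, P.Loss t x k →
        (5 + q) * a - (p + q) * b ≤ P.score p q i j k t k ∨
        a ≤ 2 * b ∧ (5 + q) * b ≤ P.score p q i j k t k := by
      intro x hx
      rcases hx.swap_cases with ⟨h1, -⟩ | ⟨h0, h1, -⟩
      · exact .inl (keepK' t h1 (hw k))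
      · refine .inr ⟨h0, ?_⟩
        have h2 := keepK t
        rcases hs.1.after ht k with h3 | ⟨-, h4⟩
        · rw [h1, h3] at h2
          linarith
        · linarith [o.M_last t]
    have hi_cases : P.M t i = P.w t i i ∨ P.Loss t i k :=
      (o.first_cases t).imp_right fun h =>
        h.resolve_left fun h' => absurd (hlast t h') (not_le.mpr ht)
    have hj_loss : P.PureLoss t j k →
        (24 - (p + q)) * b + (q - 19) * a + p * b ≤ P.score p q i j k t j := by
      intro h
      have := hw j
      rw [lossJ t h]
      nlinarith
    rcases hi_cases with h1 | h1
    · obtain ⟨h3, h4⟩ := hs.1.own_eq_zero ht h1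
      have hi0 : 0 ≤ P.score p q i j k t i := by
        unfold score
        rw [h3, h4]
        nlinarith [mul_nonneg hp (P.w_nonneg t j i), mul_nonneg hq (P.w_nonneg t k i)]
      rcases o.middle_cases t with h2 | h2
      · linarith [hj0 h2]
      · have := hj_loss h2
        rcases hkloss j h2.1 with h5 | ⟨h0, h5⟩
        · linarith
        · linarith [(hweird h0).1]
    · have hi := lossIK t h1
      rcases o.middle_cases t with h2 | h2
      · have := hj0 h2
        rcases hkloss i h1 with h5 | ⟨h0, h5⟩
        · linarith
        · linarith [(hweird h0).1]
      · have := hj_loss h2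
        rcases hkloss i h1 with h5 | ⟨h0, h5⟩
        · linarith
        · linarith [(hweird h0).2.1]

end RoundProfile

/-! ### Choice of the weights and the case distinction -/

namespace RoundProfile

variable {a b : ℝ} {T : ℕ} {P : RoundProfile a b T} {i j k : Fin 3}

theorem exists_last {p : ℕ → Prop} (h : ∃ n, p n) (hT : ∀ n, p n → n < T) :
    ∃ n, p n ∧ ∀ m, p m → m ≤ n := by
  classical
  obtain ⟨n, hn⟩ := h
  exact ⟨Nat.findGreatest p T, Nat.findGreatest_spec (hT n hn).le hn,
    fun m hm => Nat.le_findGreatest (hT m hm).le hm⟩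

/-- A larger `l` compensates losses better but makes rounds without losses worse, so `l` grows with
`a / b`. Beyond `a = 2 * b` the exceptional case disappears. -/
theorem Ordered.total_nonneg_of_last (o : P.Ordered i j k) (hlossy : ∃ t x, P.Loss t i x)
    (hij : ∀ t, ¬ P.PureLoss t i j) (hk : ∃ t x, P.PureLoss t x k) :
    0 ≤ ∑ t ∈ Finset.range T, ∑ x, (24 * P.w t x x - 19 * P.M t x) := by
  have hb := P.b_pos
  have hab := P.b_lt
  obtain ⟨Tp, ⟨m, hm⟩, hlast⟩ := exists_last hk fun t ⟨x, hx⟩ => hx.1.lt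
  have hlast' : ∀ t x, P.PureLoss t x k → t ≤ Tp := fun t x h => hlast t ⟨x, h⟩
  by_cases h1 : 10 * a ≤ 17 * b
  · exact o.total_nonneg_of_no_pureLoss (l := 5) (by norm_num) (by linarith) (by linarith)
      (by linarith) (fun _ => ⟨by linarith, by linarith⟩) hlossy hij hm hlast'
  by_cases h2 : a ≤ 2 * b
  · exact o.total_nonneg_of_no_pureLoss (l := 8) (by norm_num) (by linarith) (by linarith)
      (by linarith) (fun _ => ⟨by linarith, by linarith⟩) hlossy hij hm hlast'
  by_cases h3 : a ≤ 6 * b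
  · exact o.total_nonneg_of_no_pureLoss (l := 10) (by norm_num) (by linarith) (by linarith)
      (by linarith) (fun h => absurd h h2) hlossy hij hm hlast'
  · exact o.total_nonneg_of_no_pureLoss (l := 11) (by norm_num) (by linarith) (by linarith)
      (by linarith) (fun h => absurd h h2) hlossy hij hm hlast'

theorem Ordered.total_nonneg_of_middle (o : P.Ordered i j k) {s : ℕ} (hs : P.PureLoss s i j)
    (hlast : ∀ t, P.PureLoss t i j → t ≤ s) {t : ℕ} {m : Fin 3} (hm : P.PureLoss t m k)
    (hst : s ≤ t) : 0 ≤ ∑ t ∈ Finset.range T, ∑ x, (24 * P.w t x x - 19 * P.M t x) := by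
  have hb := P.b_pos
  have hab := P.b_lt
  by_cases h1 : 10 * a ≤ 16 * b
  · exact o.total_nonneg_of_pureLoss (p := 1) (q := 4) (by norm_num) (by norm_num) (by norm_num)
      (by linarith) (by linarith) (by linarith) (by linarith) (by linarith)
      (fun _ => ⟨by linarith, by linarith, by linarith, by linarith⟩) (fun _ => by linarith)
      hs hlast hm hst
  by_cases h2 : 20 * a ≤ 37 * b
  · exact o.total_nonneg_of_pureLoss (p := 3 / 2) (q := 7) (by norm_num) (by norm_num)
      (by norm_num) (by linarith) (by linarith) (by linarith) (by linarith) (by linarith)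
      (fun _ => ⟨by linarith, by linarith, by linarith, by linarith⟩) (fun _ => by linarith)
      hs hlast hm hst
  by_cases h3 : 10 * a ≤ 19 * b
  · exact o.total_nonneg_of_pureLoss (p := 3) (q := 8) (by norm_num) (by norm_num) (by norm_num)
      (by linarith) (by linarith) (by linarith) (by linarith) (by linarith)
      (fun _ => ⟨by linarith, by linarith, by linarith, by linarith⟩) (fun _ => by linarith)
      hs hlast hm hst
  by_cases h4 : a ≤ 2 * b
  · exact o.total_nonneg_of_pureLoss (p := 4) (q := 9) (by norm_num) (by norm_num) (by norm_num)
      (by linarith) (by linarith) (by linarith) (by linarith) (by linarith)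
      (fun _ => ⟨by linarith, by linarith, by linarith, by linarith⟩) (fun _ => by linarith)
      hs hlast hm hst
  by_cases h5 : a ≤ 3 * b
  · exact o.total_nonneg_of_pureLoss (p := 4) (q := 10) (by norm_num) (by norm_num) (by norm_num)
      (by linarith) (by linarith) (by linarith) (by linarith) (by linarith)
      (fun h => absurd h h4) (fun _ => by linarith) hs hlast hm hst
  · exact o.total_nonneg_of_pureLoss (p := 4) (q := 11) (by norm_num) (by norm_num) (by norm_num)
      (by linarith) (by linarith) (by linarith) (by linarith) (by linarith)
      (fun h => absurd h h4) (fun _ => by linarith) hs hlast hm hst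

/-- The welfare of the run is at least `19 / 24` of the maximum. -/
theorem total_nonneg (P : RoundProfile a b T) :
    0 ≤ ∑ t ∈ Finset.range T, ∑ x, (24 * P.w t x x - 19 * P.M t x) := by
  obtain ⟨i, j, k, o⟩ := P.exists_ordered
  by_cases hj : ∃ t x, P.Loss t j x
  · obtain ⟨t, x, hj⟩ := hj
    have hjk := o.pureLoss_middle hj
    by_cases hi : ∃ t x, P.Loss t i x
    · by_cases hij : ∃ t, P.PureLoss t i j
      · obtain ⟨s, hs, hlast⟩ := exists_last hij fun t h => h.1.lt
        exact o.total_nonneg_of_middle hs hlast hjk (hs.1.le_of_loss hj)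
      · push Not at hij
        exact o.total_nonneg_of_last hi hij ⟨t, j, hjk⟩
    · push Not at hi
      -- Since `i` never loses, she may be moved behind `j`.
      have o' : P.Ordered j i k :=
        ⟨o.ij.symm, o.jk, o.ik, fun t => hi t j, o.not_kj, o.not_ki⟩
      exact o'.total_nonneg_of_last ⟨t, x, hj⟩ (fun t h => o.not_ji t h.1) ⟨t, j, hjk⟩
  · push Not at hj
    have o' : P.Ordered i k j :=
      ⟨o.ik, o.ij, o.jk.symm, o.not_ki, o.not_ji, fun t => hj t k⟩
    by_cases hij : ∃ t, P.PureLoss t i j <;> by_cases hik : ∃ t, P.PureLoss t i k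
    · obtain ⟨s, hs, hlast⟩ := exists_last hij fun t h => h.1.lt
      obtain ⟨s', hs', hlast'⟩ := exists_last hik fun t h => h.1.lt
      -- As `j` has no losses, `j` and `k` are interchangeable; the one whose last pure loss is
      -- earlier takes the middle place.
      rcases le_total s s' with h | h
      · exact o.total_nonneg_of_middle hs hlast hs' h
      · exact o'.total_nonneg_of_middle hs' hlast' hs h
    · push Not at hik
      obtain ⟨s, hs⟩ := hij
      exact o'.total_nonneg_of_last ⟨s, j, hs.1⟩ hik ⟨s, i, hs⟩
    · push Not at hij
      obtain ⟨s, hs⟩ := hik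
      exact o.total_nonneg_of_last ⟨s, k, hs.1⟩ hij ⟨s, i, hs⟩
    · push Not at hij hik
      exact o.total_nonneg_of_shared hj fun t x h =>
        ⟨(o'.first_loss_cases h).resolve_left (hik t), (o.first_loss_cases h).resolve_left (hij t)⟩

end RoundProfile

/-! ### Matchings, termination, and runs as sequences of matchings -/

namespace Instance

variable {n : ℕ} {I : Instance n}

/-- Dropping edges of value zero does not change the weight, so competitors need not respect
positivity. -/
theorem weight_le_of_isMaxMatching {R : Finset (Fin I.m)} {μ ν : Fin n → Option (Fin I.m)}
    (h : I.IsMaxMatching R μ) (hR : ∀ i g, ν i = some g → g ∈ R)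
    (hinj : ∀ i j g, ν i = some g → ν j = some g → i = j) : I.weight ν ≤ I.weight μ := by
  classical
  let ν' : Fin n → Option (Fin I.m) := fun i => (ν i).filter fun g => decide (0 < I.v i g)
  have hν' : ∀ i g, ν' i = some g → ν i = some g ∧ 0 < I.v i g := by
    intro i g hg
    simpa [ν', Option.filter_eq_some_iff] using hg
  have hw : I.weight ν' = I.weight ν := by
    refine Finset.sum_congr rfl fun i _ => ?_
    cases hi : ν i with
    | none => simp [ν', hi]
    | some g =>
      by_cases hg : 0 < I.v i g
      · simp [ν', hi, Option.filter, hg]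
      · simp [ν', hi, Option.filter, le_antisymm (not_lt.mp hg) (I.v_nonneg i g)]
  rw [← hw]
  exact h.2 _ ⟨fun i g hg => ⟨hR i g (hν' i g hg).1, (hν' i g hg).2⟩,
    fun i j g hi hj => hinj i j g (hν' i g hi).1 (hν' j g hj).1⟩

theorem weight_update (μ : Fin n → Option (Fin I.m)) (i : Fin n) (o : Option (Fin I.m)) :
    I.weight (Function.update μ i o) + (μ i).elim 0 (I.v i) = I.weight μ + o.elim 0 (I.v i) := by
  unfold weight
  rw [← Finset.add_sum_erase _ _ (Finset.mem_univ i),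
    ← Finset.add_sum_erase Finset.univ (fun i => (μ i).elim 0 (I.v i)) (Finset.mem_univ i)]
  have : ∑ x ∈ Finset.univ.erase i, (Function.update μ i o x).elim 0 (I.v x) =
      ∑ x ∈ Finset.univ.erase i, (μ x).elim 0 (I.v x) :=
    Finset.sum_congr rfl fun x hx => by rw [Function.update_of_ne (Finset.ne_of_mem_erase hx)]
  rw [this, Function.update_self]
  ring

theorem update_injective {μ : Fin n → Option (Fin I.m)} {q : Fin I.m}
    (hinj : ∀ i j g, μ i = some g → μ j = some g → i = j) (hq : ∀ j, μ j ≠ some q) (i : Fin n) :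
    ∀ x y g, Function.update μ i (some q) x = some g → Function.update μ i (some q) y = some g →
      x = y := by
  intro x y g hx hy
  by_cases hxi : x = i <;> by_cases hyi : y = i
  · rw [hxi, hyi]
  · subst hxi
    rw [Function.update_self] at hx
    rw [Function.update_of_ne hyi, ← hx] at hy
    exact (hq y hy).elim
  · subst hyi
    rw [Function.update_self] at hy
    rw [Function.update_of_ne hxi, ← hy] at hx
    exact (hq x hx).elim
  · rw [Function.update_of_ne hxi] at hx
    rw [Function.update_of_ne hyi] at hy
    exact hinj x y g hx hy

theorem update_mem {R : Finset (Fin I.m)} {μ : Fin n → Option (Fin I.m)} {q : Fin I.m}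
    (hR : ∀ i g, μ i = some g → g ∈ R) (hq : q ∈ R) (i : Fin n) :
    ∀ x g, Function.update μ i (some q) x = some g → g ∈ R := by
  intro x g hx
  by_cases hxi : x = i
  · subst hxi
    rw [Function.update_self] at hx
    exact Option.some.inj hx ▸ hq
  · rw [Function.update_of_ne hxi] at hx
    exact hR x g hx

theorem le_of_unmatched {R : Finset (Fin I.m)} {μ : Fin n → Option (Fin I.m)}
    (h : I.IsMaxMatching R μ) {q : Fin I.m} (hq : q ∈ R) (hq' : ∀ j, μ j ≠ some q) (i : Fin n) :
    I.v i q ≤ (μ i).elim 0 (I.v i) := by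
  have h1 := weight_le_of_isMaxMatching h (update_mem (fun i g hg => (h.1.1 i g hg).1) hq i)
    (update_injective h.1.2 hq' i)
  have h2 := weight_update μ i (some q)
  simp only [Option.elim_some] at h2
  linarith

theorem exists_isNonWasteful (I : Instance n) (R : Finset (Fin I.m)) :
    ∃ μ, I.IsNonWasteful R μ := by
  obtain ⟨μ₀, h₀, hmax₀⟩ := Set.exists_max_image {μ | I.IsMatching R μ} I.weight
    (Set.toFinite _) ⟨fun _ => none, by simp [IsMatching]⟩
  -- Among maximum-weight matchings, one minimizing the total of `othersMax` is non-wasteful: a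
  -- wasteful exchange would keep the weight and lower this total.
  obtain ⟨μ, h, hmin⟩ := Set.exists_min_image {μ | I.IsMaxMatching R μ}
    (fun μ => ∑ i, (μ i).elim 0 (I.othersMax i)) (Set.toFinite _) ⟨μ₀, h₀, hmax₀⟩
  refine ⟨μ, h, fun i g q hg hq hq' hv => ?_⟩
  have hw := weight_update μ i (some q)
  rw [hg] at hw
  simp only [Option.elim_some, hv] at hw
  have hmem : I.IsMaxMatching R (Function.update μ i (some q)) := by
    refine ⟨⟨fun x y hx => ⟨update_mem (fun i g hg => (h.1.1 i g hg).1) hq i x y hx, ?_⟩,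
      update_injective h.1.2 hq' i⟩, fun ν hν => ?_⟩
    · by_cases hxi : x = i
      · subst hxi
        rw [Function.update_self] at hx
        rw [← Option.some.inj hx, hv]
        exact (h.1.1 x g hg).2
      · rw [Function.update_of_ne hxi] at hx
        exact (h.1.1 x y hx).2
    · have := h.2 ν hν
      linarith
  have := hmin _ hmem
  rw [← Finset.add_sum_erase _ _ (Finset.mem_univ i),
    ← Finset.add_sum_erase Finset.univ (fun x => (Function.update μ i (some q) x).elim 0
      (I.othersMax x)) (Finset.mem_univ i)] at this
  have h2 : ∑ x ∈ Finset.univ.erase i, (Function.update μ i (some q) x).elim 0 (I.othersMax x) =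
      ∑ x ∈ Finset.univ.erase i, (μ x).elim 0 (I.othersMax x) :=
    Finset.sum_congr rfl fun x hx => by rw [Function.update_of_ne (Finset.ne_of_mem_erase hx)]
  rw [h2, Function.update_self, hg] at this
  simpa using this

theorem exists_rmmStep (s : I.RMMState) (hs : s.remaining.Nonempty) : ∃ s', I.RMMStep s s' := by
  obtain ⟨μ, hμ⟩ := I.exists_isNonWasteful s.remaining
  exact ⟨⟨s.remaining.filter fun g => ∀ i, μ i ≠ some g, fun i => s.bundle i ∪ (μ i).toFinset⟩,
    hs, μ, hμ, rfl, fun _ => rfl⟩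

theorem card_remaining_lt {s s' : I.RMMState} (h : I.RMMStep s s') :
    s'.remaining.card < s.remaining.card := by
  obtain ⟨⟨g, hg⟩, μ, hμ, hrem, -⟩ := h
  obtain ⟨i, j, hij⟩ : ∃ i g, μ i = some g := by
    by_contra! hnone
    obtain ⟨i, hi⟩ := I.v_pos g
    have h1 := le_of_unmatched hμ.1 hg (fun j => hnone j g) i
    have h2 : μ i = none := Option.eq_none_iff_forall_ne_some.mpr (hnone i)
    rw [h2] at h1
    exact absurd h1 (not_le.mpr hi)
  rw [hrem]
  exact Finset.card_lt_card (Finset.filter_ssubset.mpr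
    ⟨j, (hμ.1.1.1 i j hij).1, fun hc => hc i hij⟩)

theorem wellFounded_rmmStep (I : Instance n) :
    WellFounded fun s' s : I.RMMState => I.RMMStep s s' :=
  Subrelation.wf (fun h => card_remaining_lt h)
    (InvImage.wf (fun s : I.RMMState => s.remaining.card) Nat.lt_wfRel.wf)

theorem exists_rmmOutput (I : Instance n) : ∃ A, I.RMMOutput A := by
  have h : ∀ s : I.RMMState, I.RMMReachable s → ∃ A, I.RMMOutput A := by
    intro s
    induction s using I.wellFounded_rmmStep.induction with
    | _ s ih =>
      intro hs
      by_cases hne : s.remaining.Nonempty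
      · obtain ⟨s', hs'⟩ := exists_rmmStep s hne
        exact ih s' hs' (hs.tail hs')
      · exact ⟨s.bundle, s, hs, Finset.not_nonempty_iff_eq_empty.mp hne, rfl⟩
  exact h _ Relation.ReflTransGen.refl

/-- The items that are not matched in the first `t` rounds. -/
def remainingAfter (I : Instance n) (μ : ℕ → Fin n → Option (Fin I.m)) (t : ℕ) :
    Finset (Fin I.m) :=
  Finset.univ.filter fun g => ∀ s, s < t → ∀ i, μ s i ≠ some g

theorem remainingAfter_succ (μ : ℕ → Fin n → Option (Fin I.m)) (t : ℕ) :
    I.remainingAfter μ (t + 1) = (I.remainingAfter μ t).filter fun g => ∀ i, μ t i ≠ some g := by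
  ext g
  simp only [remainingAfter, Finset.mem_filter, Finset.mem_univ, true_and]
  constructor
  · exact fun h => ⟨fun s hs => h s (by omega), h t (by omega)⟩
  · rintro ⟨h1, h2⟩ s hs
    rcases Nat.lt_succ_iff_lt_or_eq.mp hs with h | rfl
    · exact h1 s h
    · exact h2

theorem remainingAfter_congr {μ μ' : ℕ → Fin n → Option (Fin I.m)} {t : ℕ}
    (h : ∀ s, s < t → μ' s = μ s) : I.remainingAfter μ' t = I.remainingAfter μ t := by
  ext g
  simp only [remainingAfter, Finset.mem_filter, Finset.mem_univ, true_and]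
  exact forall_congr' fun s => forall_congr' fun hs => by rw [h s hs]

/-- The matchings of a complete run with `T` rounds, continued by empty matchings, and the final
bundles. -/
structure Run (I : Instance n) (A : I.Bundles) where
  T : ℕ
  μ : ℕ → Fin n → Option (Fin I.m)
  isNonWasteful : ∀ t, I.IsNonWasteful (I.remainingAfter μ t) (μ t)
  eq_none : ∀ t, T ≤ t → ∀ i, μ t i = none
  remaining_eq : I.remainingAfter μ T = ∅
  bundle_eq : ∀ i, A i = (Finset.range T).biUnion fun t => (μ t i).toFinset

theorem exists_matchings_of_reachable {s : I.RMMState} (h : I.RMMReachable s) :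
    ∃ (T : ℕ) (μ : ℕ → Fin n → Option (Fin I.m)),
      (∀ t, t < T → I.IsNonWasteful (I.remainingAfter μ t) (μ t)) ∧
      (∀ t, T ≤ t → ∀ i, μ t i = none) ∧ s.remaining = I.remainingAfter μ T ∧
      ∀ i, s.bundle i = (Finset.range T).biUnion fun t => (μ t i).toFinset := by
  induction h with
  | refl =>
    exact ⟨0, fun _ _ => none, by simp, by simp, by simp [rmmInit, remainingAfter],
      by simp [rmmInit]⟩
  | tail _ hstep ih =>
    obtain ⟨T, μ, hnw, hnone, hrem, hbun⟩ := ih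
    obtain ⟨-, ν, hν, hrem', hbun'⟩ := hstep
    have hlt : ∀ t, t < T → Function.update μ T ν t = μ t := fun t ht =>
      Function.update_of_ne ht.ne _ _
    have hcongr : ∀ t, t ≤ T →
        I.remainingAfter (Function.update μ T ν) t = I.remainingAfter μ t := fun t ht =>
      remainingAfter_congr fun s hs => hlt s (hs.trans_le ht)
    refine ⟨T + 1, Function.update μ T ν, fun t ht => ?_, fun t ht i => ?_, ?_, fun i => ?_⟩
    · rcases Nat.lt_succ_iff_lt_or_eq.mp ht with h | rfl
      · rw [hcongr t h.le, hlt t h]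
        exact hnw t h
      · rw [hcongr t le_rfl, Function.update_self, ← hrem]
        exact hν
    · rw [Function.update_of_ne (by omega)]
      exact hnone t (by omega) i
    · rw [remainingAfter_succ, hcongr T le_rfl, Function.update_self, ← hrem, hrem']
    · rw [hbun', hbun, Finset.range_add_one, Finset.biUnion_insert, Function.update_self,
        Finset.union_comm]
      congr 1
      exact Finset.biUnion_congr rfl fun t ht => by rw [hlt t (Finset.mem_range.mp ht)]

theorem nonempty_run {A : I.Bundles} (h : I.RMMOutput A) : Nonempty (I.Run A) := by
  obtain ⟨s, hs, hempty, rfl⟩ := h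
  obtain ⟨T, μ, hnw, hnone, hrem, hbun⟩ := exists_matchings_of_reachable hs
  rw [hempty] at hrem
  refine ⟨⟨T, μ, fun t => ?_, hnone, hrem.symm, hbun⟩⟩
  by_cases ht : t < T
  · exact hnw t ht
  · have h1 : I.remainingAfter μ t = ∅ := by
      rw [Finset.eq_empty_iff_forall_notMem]
      intro g hg
      refine Finset.notMem_empty g (hrem ▸ ?_)
      simp only [remainingAfter, Finset.mem_filter, Finset.mem_univ, true_and] at hg ⊢
      exact fun s hs => hg s (by omega)
    have h2 : μ t = fun _ => none := funext (hnone t (not_lt.mp ht))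
    rw [h1, h2]
    refine ⟨⟨by simp [IsMatching], fun ν hν => ?_⟩, by simp⟩
    have : ν = fun _ => none :=
      funext fun i => Option.eq_none_iff_forall_ne_some.mpr fun g hg =>
        absurd (hν.1 i g hg).1 (Finset.notMem_empty g)
    rw [this]

namespace Run

variable {A : I.Bundles} (r : I.Run A)

theorem mem_remaining {t : ℕ} {i : Fin n} {g : Fin I.m} (h : r.μ t i = some g) :
    g ∈ I.remainingAfter r.μ t := ((r.isNonWasteful t).1.1.1 i g h).1

theorem ne_some_of_lt {s t : ℕ} (hst : s < t) {i : Fin n} {g : Fin I.m} (h : r.μ t i = some g)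
    (j : Fin n) : r.μ s j ≠ some g := by
  have := r.mem_remaining h
  simp only [remainingAfter, Finset.mem_filter, Finset.mem_univ, true_and] at this
  exact this s hst j

theorem mem_remaining_of_lt {s t : ℕ} (hst : s < t) {i : Fin n} {g : Fin I.m}
    (h : r.μ t i = some g) : g ∈ I.remainingAfter r.μ s := by
  have := r.mem_remaining h
  simp only [remainingAfter, Finset.mem_filter, Finset.mem_univ, true_and] at this ⊢
  exact fun u hu => this u (hu.trans hst)

/-- An item is matched in only one round. -/
theorem round_unique {s t : ℕ} {i j : Fin n} {g : Fin I.m} (hs : r.μ s i = some g)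
    (ht : r.μ t j = some g) : s = t := by
  rcases lt_trichotomy s t with h | h | h
  · exact (r.ne_some_of_lt h ht i hs).elim
  · exact h
  · exact (r.ne_some_of_lt h hs j ht).elim

theorem agent_unique {s t : ℕ} {i j : Fin n} {g : Fin I.m} (hs : r.μ s i = some g)
    (ht : r.μ t j = some g) : i = j := by
  obtain rfl := r.round_unique hs ht
  exact (r.isNonWasteful s).1.1.2 i j g hs ht

/-- The value of agent `i` for the item that agent `j` gets in round `t`. -/
def w (t : ℕ) (i j : Fin n) : ℝ := (r.μ t j).elim 0 (I.v i)

theorem w_nonneg (t : ℕ) (i j : Fin n) : 0 ≤ r.w t i j := by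
  unfold w
  cases r.μ t j with
  | none => exact le_rfl
  | some g => exact I.v_nonneg i g

theorem dom {s t : ℕ} (hst : s < t) (i j : Fin n) : r.w t i j ≤ r.w s i i := by
  cases h : r.μ t j with
  | none =>
    have := r.w_nonneg s i i
    simpa [w, h] using this
  | some q =>
    have := le_of_unmatched (r.isNonWasteful s).1 (r.mem_remaining_of_lt hst h)
      (r.ne_some_of_lt hst h) i
    simpa [w, h] using this

theorem sum_toFinset {m : ℕ} (o : Option (Fin m)) (f : Fin m → ℝ) :
    ∑ g ∈ o.toFinset, f g = o.elim 0 f := by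
  cases o <;> simp

/-- For `f = I.v i` this carries normalization over to rounds; for `f = I.topValue` it does so for
the welfare bound. -/
theorem sum_items (f : Fin I.m → ℝ) :
    ∑ g, f g = ∑ t ∈ Finset.range r.T, ∑ i, (r.μ t i).elim 0 f := by
  have hstep : ∀ t, ∑ g ∈ I.remainingAfter r.μ t, f g =
      ∑ i, (r.μ t i).elim 0 f + ∑ g ∈ I.remainingAfter r.μ (t + 1), f g := by
    intro t
    rw [remainingAfter_succ, ← Finset.sum_filter_not_add_sum_filter (I.remainingAfter r.μ t)
      (fun g => ∀ i, r.μ t i ≠ some g)]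
    congr 1
    have hU : (I.remainingAfter r.μ t).filter (fun g => ¬ ∀ i, r.μ t i ≠ some g) =
        Finset.univ.biUnion fun i => (r.μ t i).toFinset := by
      ext g
      simp only [Finset.mem_filter, Finset.mem_biUnion, Finset.mem_univ, true_and,
        Option.mem_toFinset, Option.mem_def, not_forall, not_not]
      exact ⟨fun h => h.2, fun ⟨i, hi⟩ => ⟨r.mem_remaining hi, i, hi⟩⟩
    rw [hU, Finset.sum_biUnion]
    · exact Finset.sum_congr rfl fun i _ => sum_toFinset _ _
    · intro i _ j _ hij
      refine Finset.disjoint_left.mpr fun g hi hj => hij ?_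
      simp only [Option.mem_toFinset, Option.mem_def] at hi hj
      exact r.agent_unique hi hj
  have hsum : ∀ t, ∑ g, f g =
      ∑ s ∈ Finset.range t, ∑ i, (r.μ s i).elim 0 f + ∑ g ∈ I.remainingAfter r.μ t, f g := by
    intro t
    induction t with
    | zero => simp [remainingAfter]
    | succ t ih => rw [ih, hstep t, Finset.sum_range_succ, add_assoc]
  rw [hsum r.T, r.remaining_eq, Finset.sum_empty, add_zero]

theorem value_eq (i j : Fin n) : I.value i (A j) = ∑ t ∈ Finset.range r.T, r.w t i j := by
  unfold value
  rw [r.bundle_eq, Finset.sum_biUnion]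
  · exact Finset.sum_congr rfl fun t _ => sum_toFinset _ _
  · intro s _ t _ hst
    refine Finset.disjoint_left.mpr fun g hs ht => hst ?_
    simp only [Option.mem_toFinset, Option.mem_def] at hs ht
    exact r.round_unique hs ht

theorem welfare_eq : I.welfare A = ∑ t ∈ Finset.range r.T, ∑ i, r.w t i i := by
  unfold welfare
  rw [Finset.sum_comm]
  exact Finset.sum_congr rfl fun i _ => r.value_eq i i

theorem mem_bundle {i : Fin n} {g : Fin I.m} : g ∈ A i ↔ ∃ t, t < r.T ∧ r.μ t i = some g := by
  rw [r.bundle_eq]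
  simp

theorem isAllocation (r : I.Run A) : I.IsAllocation A := by
  intro i j hij
  refine Finset.disjoint_left.mpr fun g hi hj => hij ?_
  obtain ⟨s, -, hs⟩ := r.mem_bundle.mp hi
  obtain ⟨t, -, ht⟩ := r.mem_bundle.mp hj
  exact r.agent_unique hs ht

theorem isEF1 (r : I.Run A) : I.IsEF1 A := by
  intro i j _ hne
  have hle : I.value i (A j) ≤ r.w 0 i j + I.value i (A i) := by
    rw [r.value_eq, r.value_eq]
    cases hT : r.T with
    | zero =>
      have := r.w_nonneg 0 i j
      simpa using this
    | succ T =>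
      -- Without the item of round `0`, the item of `j` in round `t + 1` is compared with that of
      -- `i` in round `t`.
      rw [Finset.sum_range_succ', Finset.sum_range_succ, add_comm]
      have h1 := Finset.sum_le_sum fun t (_ : t ∈ Finset.range T) =>
        r.dom (Nat.lt_succ_self t) i j
      have h2 := r.w_nonneg T i i
      linarith
  have herase : ∀ g ∈ A j, I.value i ((A j).erase g) + I.v i g = I.value i (A j) := fun g hg =>
    Finset.sum_erase_add _ _ hg
  cases h0 : r.μ 0 j with
  | none =>
    obtain ⟨g, hg⟩ := hne
    refine ⟨g, hg, ?_⟩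
    have h1 := I.v_nonneg i g
    have h2 : r.w 0 i j = 0 := by simp [w, h0]
    linarith [herase g hg]
  | some g =>
    have hT : 0 < r.T := by
      by_contra hT
      have := r.eq_none 0 (by omega) j
      simp [this] at h0
    have hg : g ∈ A j := r.mem_bundle.mpr ⟨0, hT, h0⟩
    refine ⟨g, hg, ?_⟩
    have h2 : r.w 0 i j = I.v i g := by simp [w, h0]
    linarith [herase g hg]

theorem nonWasteful_w {s t : ℕ} (hst : s < t) {i j : Fin n} {c : ℝ} (hpos : 0 < r.w s i i)
    (heq : r.w t i j = r.w s i i) (hc : ∀ l, l ≠ i → r.w t l j ≤ c) (l : Fin n) (hl : l ≠ i) :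
    r.w s l i ≤ c := by
  cases hg : r.μ s i with
  | none => simp [w, hg] at hpos
  | some g =>
    cases hq : r.μ t j with
    | none =>
      rw [← heq] at hpos
      simp [w, hq] at hpos
    | some q =>
      have h1 := (r.isNonWasteful s).2 i g q hg (r.mem_remaining_of_lt hst hq)
        (r.ne_some_of_lt hst hq) (by simpa [w, hg, hq] using heq)
      have h2 : I.v l g ≤ I.othersMax i g :=
        le_ciSup (f := fun j : {j : Fin n // j ≠ i} => I.v j g) (Set.finite_range _).bddAbove
          ⟨l, hl⟩
      have h3 : I.othersMax i q ≤ c := by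
        have : Nonempty {j : Fin n // j ≠ i} := ⟨⟨l, hl⟩⟩
        refine ciSup_le fun x => ?_
        have := hc x x.2
        simpa [w, hq] using this
      have : r.w s l i = I.v l g := by simp [w, hg]
      linarith

theorem sum_perm_le (t : ℕ) (σ : Equiv.Perm (Fin n)) :
    ∑ x, r.w t x (σ x) ≤ ∑ x, r.w t x x :=
  weight_le_of_isMaxMatching (ν := fun x => r.μ t (σ x)) (r.isNonWasteful t).1
    (fun _ _ hg => r.mem_remaining hg)
    fun _ _ _ hi hj => σ.injective (r.agent_unique hi hj)

end Run

end Instance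

/-! ### Top values and the guarantee -/

namespace Instance

variable {n : ℕ} {I : Instance n}

/-- The maximum value of an agent for the item `g`. -/
noncomputable def topValue (I : Instance n) (g : Fin I.m) : ℝ := ⨆ i, I.v i g

theorem le_topValue (i : Fin n) (g : Fin I.m) : I.v i g ≤ I.topValue g :=
  le_ciSup (f := fun i => I.v i g) (Set.finite_range _).bddAbove i

theorem topValue_pos (g : Fin I.m) : 0 < I.topValue g := by
  obtain ⟨i, hi⟩ := I.v_pos g
  exact hi.trans_le (le_topValue i g)

theorem welfare_le_sum_topValue {B : I.Bundles} (hB : I.IsAllocation B) :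
    I.welfare B ≤ ∑ g, I.topValue g := by
  calc I.welfare B ≤ ∑ i, ∑ g ∈ B i, I.topValue g :=
        Finset.sum_le_sum fun i _ => Finset.sum_le_sum fun g _ => le_topValue i g
    _ = ∑ g ∈ Finset.univ.biUnion B, I.topValue g :=
        (Finset.sum_biUnion fun i _ j _ hij => hB i j hij).symm
    _ ≤ ∑ g, I.topValue g :=
        Finset.sum_le_sum_of_subset_of_nonneg (Finset.subset_univ _)
          fun g _ _ => (topValue_pos g).le

theorem maxWelfare_le (I : Instance n) : I.maxWelfare ≤ ∑ g, I.topValue g := by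
  refine csSup_le ⟨_, fun _ => ∅, fun _ _ _ => Finset.disjoint_empty_left _, rfl⟩ ?_
  rintro _ ⟨B, hB, rfl⟩
  exact welfare_le_sum_topValue hB

theorem welfare_le_maxWelfare {B : I.Bundles} (hB : I.IsAllocation B) :
    I.welfare B ≤ I.maxWelfare :=
  le_csSup ((Set.toFinite _).image _).bddAbove ⟨B, hB, rfl⟩

theorem welfare_le_maxWelfareEF1 {B : I.Bundles} (hB : I.IsAllocation B) (hB' : I.IsEF1 B) :
    I.welfare B ≤ I.maxWelfareEF1 :=
  le_csSup ((Set.toFinite _).image _).bddAbove ⟨B, ⟨hB, hB'⟩, rfl⟩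

namespace Run

/-- The values in a run for a ternary instance with three agents. -/
noncomputable def profile {I : Instance 3} {A : I.Bundles} (r : I.Run A) {a b : ℝ} (hb : 0 < b)
    (hab : b < a) (hv : ∀ i g, I.v i g = a ∨ I.v i g = b ∨ I.v i g = 0) :
    RoundProfile a b r.T where
  w := r.w
  M t j := (r.μ t j).elim 0 I.topValue
  b_pos := hb
  b_lt := hab
  ternary t i j := by
    unfold w
    cases r.μ t j with
    | none => exact .inr (.inr rfl)
    | some g => exact hv i g
  le_M t i j := by
    unfold w
    cases r.μ t j with
    | none => exact le_rfl
    | some g => exact le_topValue i g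
  M_eq t j := by
    unfold w
    cases r.μ t j with
    | none => exact ⟨0, rfl⟩
    | some g =>
      obtain ⟨i, hi⟩ := exists_eq_ciSup_of_finite (f := fun i => I.v i g)
      exact ⟨i, hi.symm⟩
  M_eq_zero t j h := by
    cases hg : r.μ t j with
    | none => rfl
    | some g =>
      have := ((r.isNonWasteful t).1.1.1 j g hg).2
      simp [w, hg] at h
      linarith
  swap t i j hij := by
    obtain ⟨k, hik, hjk⟩ := (by decide : ∀ i j : Fin 3, ∃ k, i ≠ k ∧ j ≠ k) i j
    have := r.sum_perm_le t (Equiv.swap i j)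
    rw [RoundProfile.sum_distinct hij hik hjk, RoundProfile.sum_distinct hij hik hjk,
      Equiv.swap_apply_left, Equiv.swap_apply_right,
      Equiv.swap_apply_of_ne_of_ne hik.symm hjk.symm] at this
    linarith
  rotate t i j k hij hik hjk := by
    have := r.sum_perm_le t (Equiv.swap i j * Equiv.swap i k)
    rw [RoundProfile.sum_distinct hij hik hjk, RoundProfile.sum_distinct hij hik hjk] at this
    simp only [Equiv.Perm.coe_mul, Function.comp_apply, Equiv.swap_apply_left,
      Equiv.swap_apply_right, Equiv.swap_apply_of_ne_of_ne hik.symm hjk.symm,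
      Equiv.swap_apply_of_ne_of_ne hij.symm hjk] at this
    linarith
  dom _ _ i j hst := r.dom hst i j
  nonWasteful _ _ _ _ _ hst hpos heq hc := r.nonWasteful_w hst hpos heq hc
  zero_of_le t i j ht := by simp [w, r.eq_none t ht j]
  normalized i j := by
    have := I.normalized i j
    rwa [r.sum_items, r.sum_items] at this

theorem sum_topValue_le {I : Instance 3} {A : I.Bundles} (r : I.Run A) (hI : I.IsTernary) :
    19 * ∑ g, I.topValue g ≤ 24 * I.welfare A := by
  obtain ⟨a, b, hb, hab, hv⟩ := hI
  have h := (r.profile hb hab hv).total_nonneg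
  simp only [profile, Finset.sum_sub_distrib, ← Finset.mul_sum] at h
  rw [r.sum_items, r.welfare_eq]
  linarith

end Run

theorem RMMOutput.guarantee {I : Instance 3} (hI : I.IsTernary) {A : I.Bundles}
    (hA : I.RMMOutput A) : I.IsAllocation A ∧ I.IsEF1 A ∧ 0 < I.welfare A ∧
      I.maxWelfare / I.welfare A ≤ 24 / 19 := by
  obtain ⟨r⟩ := nonempty_run hA
  have h1 := r.sum_topValue_le hI
  have h2 := I.maxWelfare_le
  have h3 : 0 < ∑ g, I.topValue g :=
    Finset.sum_pos (fun g _ => topValue_pos g) ⟨⟨0, by have := I.two_le_m; omega⟩, by simp⟩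
  have h4 : 0 < I.welfare A := by linarith
  refine ⟨r.isAllocation, r.isEF1, h4, ?_⟩
  rw [div_le_div_iff₀ h4 (by norm_num)]
  linarith

/-! ### The lower bound `6/5` -/

/-- Agent `0` has value `1` for each of six items; agents `1` and `2` have value `2` for three
items each, which are different. -/
noncomputable def splitInstance : Instance 3 where
  m := 6
  two_le_m := by norm_num
  v := ![![1, 1, 1, 1, 1, 1], ![2, 2, 2, 0, 0, 0], ![0, 0, 0, 2, 2, 2]]
  v_nonneg i g := by fin_cases i <;> fin_cases g <;> norm_num
  v_pos g := ⟨0, by fin_cases g <;> norm_num⟩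
  normalized i j := by
    have h : ∀ i : Fin 3, ∑ g : Fin 6, (![![1, 1, 1, 1, 1, 1], ![2, 2, 2, 0, 0, 0],
        ![0, 0, 0, 2, 2, 2]] : Fin 3 → Fin 6 → ℝ) i g = 6 := by
      intro i
      fin_cases i <;> simp [Fin.sum_univ_six] <;> norm_num
    rw [h i, h j]

theorem splitInstance_isTernary : splitInstance.IsTernary := by
  refine ⟨2, 1, by norm_num, by norm_num, fun i (g : Fin 6) => ?_⟩
  fin_cases i <;> fin_cases g <;> simp [splitInstance]

theorem le_maxWelfare_splitInstance : 12 ≤ splitInstance.maxWelfare := by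
  let B : Fin 3 → Finset (Fin 6) := ![∅, {0, 1, 2}, {3, 4, 5}]
  have hB : splitInstance.IsAllocation B :=
    (by decide : ∀ i j, i ≠ j → Disjoint (B i) (B j))
  refine le_trans (le_of_eq ?_) (welfare_le_maxWelfare hB)
  simp [welfare, value, splitInstance, B, Fin.sum_univ_three]
  norm_num

theorem value_zero_splitInstance (S : Finset (Fin splitInstance.m)) :
    splitInstance.value 0 S = S.card := by
  have h : ∀ g, splitInstance.v 0 g = 1 := fun (g : Fin 6) => by
    fin_cases g <;> simp [splitInstance]
  exact (Finset.sum_congr rfl fun g _ => h g).trans (by simp)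

theorem value_le_splitInstance (i : Fin 3) (S : Finset (Fin splitInstance.m)) :
    splitInstance.value i S ≤ 2 * S.card := by
  have h : ∀ g, splitInstance.v i g ≤ 2 := fun (g : Fin 6) => by
    fin_cases i <;> fin_cases g <;> simp [splitInstance]
  exact (Finset.sum_le_sum fun g _ => h g).trans_eq (by simp [mul_comm])

theorem maxWelfareEF1_splitInstance_le : splitInstance.maxWelfareEF1 ≤ 10 := by
  refine csSup_le ⟨_, fun _ => ∅, ⟨fun _ _ _ => Finset.disjoint_empty_left _,
    fun _ _ _ h => absurd h Finset.not_nonempty_empty⟩, rfl⟩ ?_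
  rintro _ ⟨A, ⟨hA, hEF⟩, rfl⟩
  -- Agent `0` merely counts items, so EF1 for her bounds the sizes of the other bundles; this alone
  -- limits the welfare to `10`.
  have hcard : ∀ j : Fin 3, 0 ≠ j → (A j).card ≤ (A 0).card + 1 := by
    intro j hj
    by_cases hne : (A j).Nonempty
    · obtain ⟨g, hg, hle⟩ := hEF 0 j hj hne
      rw [value_zero_splitInstance, value_zero_splitInstance, Nat.cast_le,
        Finset.card_erase_of_mem hg] at hle
      omega
    · simp [Finset.not_nonempty_iff_eq_empty.mp hne]
  have h1 := hcard 1 (by decide)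
  have h2 := hcard 2 (by decide)
  have htotal : (A 0).card + (A 1).card + (A 2).card ≤ 6 := by
    rw [← Finset.card_union_of_disjoint (hA 0 1 (by decide)), ← Finset.card_union_of_disjoint
      (Finset.disjoint_union_left.mpr ⟨hA 0 2 (by decide), hA 1 2 (by decide)⟩)]
    exact (Finset.card_le_univ _).trans_eq (Fintype.card_fin 6)
  have hw : splitInstance.welfare A ≤ (A 0).card + 2 * (A 1).card + 2 * (A 2).card := by
    have h1 := value_le_splitInstance 1 (A 1)
    have h2 := value_le_splitInstance 2 (A 2)
    have h0 := value_zero_splitInstance (A 0)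
    rw [welfare, Fin.sum_univ_three]
    linarith
  have : (A 0).card + 2 * (A 1).card + 2 * (A 2).card ≤ 10 := by omega
  exact hw.trans (by exact_mod_cast this)

end Instance

theorem theorem5 :
    (∀ I : Instance 3, I.IsTernary →
      WellFounded (fun s' s : I.RMMState => I.RMMStep s s') ∧
      (∀ s, I.RMMReachable s → s.remaining.Nonempty → ∃ s', I.RMMStep s s') ∧
      ∀ A, I.RMMOutput A →
        I.IsAllocation A ∧ I.IsEF1 A ∧
        0 < I.welfare A ∧ I.maxWelfare / I.welfare A ≤ 24 / 19) ∧
    ((6 / 5 : ℝ) : EReal) ≤ ternaryPriceEF1 3 ∧ ternaryPriceEF1 3 ≤ ((24 / 19 : ℝ) : EReal) := by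
  have hpos : ∀ I : Instance 3, I.IsTernary → 0 < I.maxWelfareEF1 ∧
      I.maxWelfare / I.maxWelfareEF1 ≤ 24 / 19 := by
    intro I hI
    obtain ⟨A, hA⟩ := I.exists_rmmOutput
    obtain ⟨h1, h2, h3, h4⟩ := hA.guarantee hI
    have h5 := Instance.welfare_le_maxWelfareEF1 h1 h2
    have h6 := Instance.welfare_le_maxWelfare h1
    exact ⟨h3.trans_le h5, (div_le_div_of_nonneg_left (h3.le.trans h6) h3 h5).trans h4⟩
  refine ⟨fun I hI => ⟨I.wellFounded_rmmStep, fun s _ hs => Instance.exists_rmmStep s hs,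
    fun A hA => hA.guarantee hI⟩, ?_, ?_⟩
  · refine le_trans ?_ (le_iSup₂ (f := fun (I : Instance 3) (_ : I.IsTernary) =>
      ((I.maxWelfare / I.maxWelfareEF1 : ℝ) : EReal)) Instance.splitInstance
      Instance.splitInstance_isTernary)
    rw [EReal.coe_le_coe_iff,
      div_le_div_iff₀ (by norm_num) (hpos _ Instance.splitInstance_isTernary).1]
    linarith [Instance.le_maxWelfare_splitInstance, Instance.maxWelfareEF1_splitInstance_le]
  · exact iSup₂_le fun I hI => EReal.coe_le_coe_iff.mpr (hpos I hI).2
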